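/- Let $\Sigma$ be a finite alphabet. A timed word is a finite sequence $(t_1\cdot a_1)\cdots(t_n\cdot a_n)$ with $t_i\in\mathbb{R}_{\ge 0}$ and $a_i\in\Sigma$; a timed language is a set of timed words, and $u^{-1}L=\{w\mid uw\in L\}$. **Automata.** A timed automaton with integer resets (IRTA) is a nondeterministic timed automaton with finitely many states and transitions and finitely many clocks, all initially $0$, whose guards are conjunctions of comparisons of clocks with natural numbers, and in which every transition that resets some clock has a guard that forces $x=c$ for some clock $x$ and some $c\in\mathbb{N}$. A one-clock IRTA has a single clock $x$ and guards $\phi ::= x<m\mid m<x\mid x=m\mid\phi\wedge\phi$ $(m\in\mathbb{N})$, the guard of each resetting transition is satisfied by exactly one clock value, which is a natural number, and every timed word admits a run. **Regions and $c^K$.** Let $K\in\mathbb{N}$. For $x,y\in\mathbb{R}_{\ge 0}$ write $x\equiv^K y$ if either $\lfloor x\rfloor=\lfloor y\rfloor$ and ($\{x\}=0\Leftrightarrow\{y\}=0$), or $x>K$ and $y>K$. For a sequence of delays $d=t_1\cdots t_n$ let $0=i_0<i_1<\dots<i_p\le n$ be the longest sequence of indices such that each sum $t_{i_j+1}+\dots+t_{i_{j+1}}$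 is an integer between $0$ and $K$, and put $c^K(d)=t_{i_p+1}+\dots+t_n$. For a timed word $u$, $c^K(u)$ is $c^K$ of its sequence of delays. **Rescaling.** For $\lambda,\lambda'\in(0,1)$ let $f_{\lambda\to\lambda'}(s)=\frac{\lambda'}{\lambda}s$ for $0\le s\le\lambda$ and $f_{\lambda\to\lambda'}(s)=\lambda'+\frac{1-\lambda'}{1-\lambda}(s-\lambda)$ for $\lambda<s<1$. For $x\equiv^K x'$ define $\tau_{x\to x'}$ on finite sequences of delays by $\tau_{x\to x'}(\epsilon)=\epsilon$ and $\tau_{x\to x'}(d\,t)=d'\,t'$, where $d'=\tau_{x\to x'}(d)$ and, with $y=c^K(xd)$ and $y'=c^K(x'd')$: if $y,y'\in\mathbb{N}$ or $y,y'>K$, then $t'=t$; otherwise $\lfloor t'\rfloor=\lfloor t\rfloor$ and $\{t'\}=f_{(1-\{y\})\to(1-\{y'\})}(\{t\})$. On timed words, $\tau_{x\to x'}$ acts on the delays and keeps the letters. **Equivalences.** For a timed language $L$, write $u\approx^{L,K}v$ if $c^K(u)\equiv^K c^K(v)$ and $\tau_{c^K(u)\to c^K(v)}(u^{-1}L)=v^{-1}L$.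 An equivalence $\approx$ on timed words is $L$-preserving if $u\approx v$ implies ($u\in L\Leftrightarrow v\in L$). It is $K$-monotonic if $u\approx v$ implies that $c^K(u)\equiv^K c^K(v)$ and that, for all $a\in\Sigma$ and $t,t'\in\mathbb{R}_{\ge0}$, $c^K(u)+t\equiv^K c^K(v)+t'$ implies $u(t\cdot a)\approx v(t'\cdot a)$. It has finite index if it has finitely many classes. **Theorem.** Let $L$ be a timed language over $\Sigma$. For every $K\in\mathbb{N}$, $\approx^{L,K}$ is an equivalence relation, and: (a) $L$ is accepted by an IRTA if and only if there is a $K\in\mathbb{N}$ such that $\approx^{L,K}$ is $K$-monotonic and has finite index. The same equivalence holds with "one-clock IRTA" in place of "IRTA". (b) For every $K\in\mathbb{N}$, $\approx^{L,K}$ is coarser than every $K$-monotonic, $L$-preserving equivalence $\approx$ on timed words: $u\approx v$ implies $u\approx^{L,K}v$. -/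

import Mathlib

open scoped NNReal

noncomputable section

namespace IRTA

/-! ### Timed words -/

/-- A timed word `(t₁ · a₁) ⋯ (tₙ · aₙ)`: a finite sequence of pairs (delay, letter). -/
abbrev TimedWord (A : Type*) := List (ℝ≥0 × A)

/-- The timestamp `t₁ ⋯ tₙ` of a timed word. -/
def timestamp {A : Type*} (w : TimedWord A) : List ℝ≥0 := w.map Prod.fst

/-- The residual language `u⁻¹L = {w | uw ∈ L}`. -/
def residual {A : Type*} (L : Set (TimedWord A)) (u : TimedWord A) : Set (TimedWord A) :=
  {w | u ++ w ∈ L}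

/-! ### One-clock timed automata -/

/-- Clock constraints `φ ::= x < m | m < x | x = m | φ ∧ φ` over a single clock `x`. -/
inductive OneGuard : Type
  | lt (m : ℕ) : OneGuard
  | gt (m : ℕ) : OneGuard
  | eq (m : ℕ) : OneGuard
  | and (φ ψ : OneGuard) : OneGuard

/-- The set `⟦φ⟧` of clock values that satisfy `φ`. -/
def OneGuard.denote : OneGuard → Set ℝ≥0
  | .lt m => {x | x < m}
  | .gt m => {x | (m : ℝ≥0) < x}
  | .eq m => {x | x = m}
  | .and φ ψ => φ.denote ∩ ψ.denote

/-- A one-clock timed automaton. In a transition `(q, q', a, φ, r)`, the bit `r` is the factor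
by which the clock is multiplied: `r = 0` means that the clock is reset, `r = 1` that it is not. -/
structure OneTA (A : Type*) where
  State : Type
  finite_state : Finite State
  init : State
  trans : Set (State × State × A × OneGuard × Fin 2)
  finite_trans : trans.Finite
  final : Set State

/-- `B.Run q x w q' x'`: there is a run of `B` on `w` from the configuration `(q, x)` to the
configuration `(q', x')`. -/
inductive OneTA.Run {A : Type*} (B : OneTA A) :
    B.State → ℝ≥0 → TimedWord A → B.State → ℝ≥0 → Prop
  | nil (q : B.State) (x : ℝ≥0) : OneTA.Run B q x [] q x
  | cons {q q₁ q' : B.State} {x x' t : ℝ≥0} {a : A} {w : TimedWord A} {φ : OneGuard} {r : Fin 2} :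
      (q, q₁, a, φ, r) ∈ B.trans → x + t ∈ φ.denote →
      OneTA.Run B q₁ ((r : ℕ) * (x + t)) w q' x' →
      OneTA.Run B q x ((t, a) :: w) q' x'

/-- The language accepted from the initial configuration. -/
def OneTA.language {A : Type*} (B : OneTA A) : Set (TimedWord A) :=
  {w | ∃ q ∈ B.final, ∃ x : ℝ≥0, B.Run B.init 0 w q x}

/-- Every timed word admits a run. -/
def OneTA.Complete {A : Type*} (B : OneTA A) : Prop :=
  ∀ w : TimedWord A, ∃ (q : B.State) (x : ℝ≥0), B.Run B.init 0 w q x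

/-- Integer resets: the guard of every resetting transition amounts to `x = m`, `m ∈ ℕ`. -/
def OneTA.IntegerReset {A : Type*} (B : OneTA A) : Prop :=
  ∀ (q q' : B.State) (a : A) (φ : OneGuard), (q, q', a, φ, (0 : Fin 2)) ∈ B.trans →
    ∃ m : ℕ, φ.denote = {(m : ℝ≥0)}

/-- `L` is accepted by a complete one-clock timed automaton with integer resets. -/
def OneClockIRTADefinable {A : Type*} (L : Set (TimedWord A)) : Prop :=
  ∃ B : OneTA A, B.IntegerReset ∧ B.Complete ∧ B.language = L

/-! ### Timed automata with several clocks -/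

/-- Guards over a set `C` of clocks: conjunctions of comparisons of clocks with integers. -/
inductive Guard (C : Type) : Type
  | tt : Guard C
  | lt (x : C) (m : ℕ) : Guard C
  | le (x : C) (m : ℕ) : Guard C
  | eq (x : C) (m : ℕ) : Guard C
  | ge (x : C) (m : ℕ) : Guard C
  | gt (x : C) (m : ℕ) : Guard C
  | and (φ ψ : Guard C) : Guard C

/-- The set of clock valuations that satisfy a guard. -/
def Guard.denote {C : Type} : Guard C → Set (C → ℝ≥0)
  | .tt => Set.univ
  | .lt x m => {ν | ν x < m}
  | .le x m => {ν | ν x ≤ m}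
  | .eq x m => {ν | ν x = m}
  | .ge x m => {ν | (m : ℝ≥0) ≤ ν x}
  | .gt x m => {ν | (m : ℝ≥0) < ν x}
  | .and φ ψ => φ.denote ∩ ψ.denote

/-- A (nondeterministic) timed automaton with clocks in `C`; a transition `(q, q', a, φ, R)`
resets the clocks in `R`. -/
structure TA (A : Type*) (C : Type) where
  State : Type
  finite_state : Finite State
  init : Set State
  trans : Set (State × State × A × Guard C × Set C)
  finite_trans : trans.Finite
  final : Set State

open Classical in
/-- The valuation after the clocks in `R` have been reset. -/
def resetClocks {C : Type} (R : Set C) (ν : C → ℝ≥0) : C → ℝ≥0 :=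
  fun x => if x ∈ R then 0 else ν x

/-- `B.Run q ν w q' ν'`: there is a run of `B` on `w` from `(q, ν)` to `(q', ν')`. -/
inductive TA.Run {A : Type*} {C : Type} (B : TA A C) :
    B.State → (C → ℝ≥0) → TimedWord A → B.State → (C → ℝ≥0) → Prop
  | nil (q : B.State) (ν : C → ℝ≥0) : TA.Run B q ν [] q ν
  | cons {q q₁ q' : B.State} {ν ν' : C → ℝ≥0} {t : ℝ≥0} {a : A} {w : TimedWord A}
      {φ : Guard C} {R : Set C} :
      (q, q₁, a, φ, R) ∈ B.trans → (fun x => ν x + t) ∈ φ.denote →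
      TA.Run B q₁ (resetClocks R fun x => ν x + t) w q' ν' →
      TA.Run B q ν ((t, a) :: w) q' ν'

/-- The language accepted from the initial configurations, where all clocks are `0`. -/
def TA.language {A : Type*} {C : Type} (B : TA A C) : Set (TimedWord A) :=
  {w | ∃ q₀ ∈ B.init, ∃ q ∈ B.final, ∃ ν : C → ℝ≥0, B.Run q₀ (fun _ => 0) w q ν}

/-- Integer resets: a transition that resets some clock has a guard that forces `x = c` for some
clock `x` and some integer `c` (as it does when `x = c` is one of its conjuncts). -/
def TA.IntegerReset {A : Type*} {C : Type} (B : TA A C) : Prop :=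
  ∀ (q q' : B.State) (a : A) (φ : Guard C) (R : Set C), (q, q', a, φ, R) ∈ B.trans →
    R.Nonempty → ∃ (x : C) (c : ℕ), ∀ ν ∈ φ.denote, ν x = c

/-- `L` is accepted by a timed automaton with integer resets, with finitely many clocks. -/
def IRTADefinable {A : Type*} (L : Set (TimedWord A)) : Prop :=
  ∃ C : Type, Finite C ∧ ∃ B : TA A C, B.IntegerReset ∧ B.language = L

/-! ### Region equivalence and the value `c^K` -/

/-- The region equivalence `≡^K` on non-negative reals. -/
def RegionEq (K : ℕ) (x y : ℝ≥0) : Prop :=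
  (⌊x⌋₊ = ⌊y⌋₊ ∧ (Int.fract (x : ℝ) = 0 ↔ Int.fract (y : ℝ) = 0)) ∨
    ((K : ℝ≥0) < x ∧ (K : ℝ≥0) < y)

open Classical in
/-- `x` is replaced by `0` if it is an integer between `0` and `K`, and kept otherwise. -/
def resetAt (K : ℕ) (x : ℝ≥0) : ℝ≥0 :=
  if ∃ m : ℕ, m ≤ K ∧ x = m then 0 else x

/-- The value `c^K(d)` of a timestamp `d`: the sum of the delays after the last integral position,
where a position is integral as soon as the sum of the delays since the previous integral position
is an integer between `0` and `K`. The theorem `clock_eq_of_longest` below identifies it with the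
definition through a longest sequence of indices. -/
def clock (K : ℕ) (d : List ℝ≥0) : ℝ≥0 :=
  d.foldl (fun x t => resetAt K (x + t)) 0

/-- The value `c^K(u)` of a timed word. -/
def wordClock {A : Type*} (K : ℕ) (u : TimedWord A) : ℝ≥0 := clock K (timestamp u)

theorem clock_nil (K : ℕ) : clock K [] = 0 := rfl

theorem clock_append_singleton (K : ℕ) (d : List ℝ≥0) (t : ℝ≥0) :
    clock K (d ++ [t]) = resetAt K (clock K d + t) := by
  simp [clock]

/-- `IsIntegralSeq K d s i`: `s` is a sequence `0 = i₀ < i₁ < ⋯ < iₚ ≤ n` of indices of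
`d = t₁ ⋯ tₙ`, with last entry `i = iₚ`, such that the sum of the delays between any two
consecutive indices is an integer between `0` and `K`. -/
inductive IsIntegralSeq (K : ℕ) (d : List ℝ≥0) : List ℕ → ℕ → Prop
  | start : IsIntegralSeq K d [0] 0
  | extend {s : List ℕ} {i j : ℕ} : IsIntegralSeq K d s i → i < j → j ≤ d.length →
      (∃ m : ℕ, m ≤ K ∧ ((d.take j).drop i).sum = m) → IsIntegralSeq K d (s ++ [j]) j

theorem IsIntegralSeq.le_length {K : ℕ} {d : List ℝ≥0} {s : List ℕ} {i : ℕ}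
    (h : IsIntegralSeq K d s i) : i ≤ d.length := by
  cases h with
  | start => exact Nat.zero_le _
  | extend _ _ h _ => exact h

theorem IsIntegralSeq.length_le {K : ℕ} {d : List ℝ≥0} {s : List ℕ} {i : ℕ}
    (h : IsIntegralSeq K d s i) : s.length ≤ i + 1 := by
  induction h with
  | start => simp
  | extend _ h1 _ _ ih => simp; omega

theorem IsIntegralSeq.restrict {K : ℕ} {d : List ℝ≥0} {t : ℝ≥0} {s : List ℕ} {i : ℕ}
    (h : IsIntegralSeq K (d ++ [t]) s i) (hi : i ≤ d.length) : IsIntegralSeq K d s i := by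
  induction h with
  | start => exact .start
  | extend _ h1 _ h3 ih =>
    rw [List.take_append_of_le_length hi] at h3
    exact .extend (ih (by omega)) h1 hi h3

theorem resetAt_eq_zero {K m : ℕ} {x : ℝ≥0} (hm : m ≤ K) (hx : x = m) : resetAt K x = 0 :=
  if_pos ⟨m, hm, hx⟩

theorem IsIntegralSeq.sum_drop {K : ℕ} {d : List ℝ≥0} : ∀ {s : List ℕ} {i : ℕ},
    IsIntegralSeq K d s i → ∃ n : ℕ, (d.drop i).sum = n + clock K d := by
  induction d using List.reverseRecOn with
  | nil => intro s i _; exact ⟨0, by simp [clock]⟩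
  | append_singleton d t ih =>
    intro s i h
    by_cases hi : i ≤ d.length
    · obtain ⟨n, hn⟩ := ih (h.restrict hi)
      rw [List.drop_append_of_le_length hi, List.sum_append, hn, clock_append_singleton]
      by_cases hm : ∃ m : ℕ, m ≤ K ∧ clock K d + t = m
      · obtain ⟨m, hmK, hm⟩ := hm
        refine ⟨n + m, ?_⟩
        rw [resetAt_eq_zero hmK hm]
        simp [add_assoc, hm]
      · exact ⟨n, by simp [resetAt, if_neg hm, add_assoc]⟩
    · have hl := h.le_length
      simp only [List.length_append, List.length_singleton] at hl
      have hi' : i = d.length + 1 := by omega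
      subst hi'
      refine ⟨0, ?_⟩
      cases h with
      | @extend s' i' _ h0 h1 _ h3 =>
        obtain ⟨m, hmK, hm⟩ := h3
        have hi1 : i' ≤ d.length := by omega
        obtain ⟨n, hn⟩ := ih (h0.restrict hi1)
        rw [List.take_of_length_le (by simp), List.drop_append_of_le_length hi1,
          List.sum_append, hn] at hm
        simp only [List.sum_singleton] at hm
        have hnm : n ≤ m := by
          have : (n : ℝ≥0) ≤ m := by
            rw [← hm, add_assoc]; exact le_self_add
          exact_mod_cast this
        have hc : clock K d + t = ((m - n : ℕ) : ℝ≥0) := by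
          have h2 : (n : ℝ≥0) + (clock K d + t) = n + ((m - n : ℕ) : ℝ≥0) := by
            rw [← add_assoc, hm, ← Nat.cast_add, Nat.add_sub_cancel' hnm]
          exact add_left_cancel h2
        rw [clock_append_singleton, resetAt_eq_zero (by omega) hc]
        simp

theorem IsIntegralSeq.clock_eq {K : ℕ} {d : List ℝ≥0} : ∀ {s : List ℕ} {i : ℕ},
    IsIntegralSeq K d s i →
    (∀ j, i < j → j ≤ d.length → ¬ ∃ m : ℕ, m ≤ K ∧ ((d.take j).drop i).sum = m) →
    clock K d = (d.drop i).sum := by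
  induction d using List.reverseRecOn with
  | nil => intro s i _ _; simp [clock]
  | append_singleton d t ih =>
    intro s i h hmax
    by_cases hi : i ≤ d.length
    · have h1 := ih (h.restrict hi) (fun j h1 h2 => by
        have := hmax j h1 (by simp; omega)
        rwa [List.take_append_of_le_length h2] at this)
      have h2 := hmax (d.length + 1) (by omega) (by simp)
      rw [List.take_of_length_le (by simp), List.drop_append_of_le_length hi, List.sum_append,
        ← h1, List.sum_singleton] at h2
      rw [clock_append_singleton, List.drop_append_of_le_length hi, List.sum_append, ← h1,
        List.sum_singleton, resetAt, if_neg h2]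
    · have hl := h.le_length
      obtain ⟨n, hn⟩ := h.sum_drop
      rw [List.drop_of_length_le (by simp at hl ⊢; omega), List.sum_nil] at hn ⊢
      exact (add_eq_zero.1 hn.symm).2

/-- A longest sequence of integral positions exists, and for every such sequence `c^K(d)` is the
sum of the delays after its last entry. -/
theorem clock_eq_of_longest (K : ℕ) (d : List ℝ≥0) :
    (∃ s i, IsIntegralSeq K d s i ∧
      ∀ s' i', IsIntegralSeq K d s' i' → s'.length ≤ s.length) ∧
    ∀ s i, IsIntegralSeq K d s i →
      (∀ s' i', IsIntegralSeq K d s' i' → s'.length ≤ s.length) →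
      clock K d = (d.drop i).sum := by
  constructor
  · classical
    let P : ℕ → Prop := fun n => ∃ s i, IsIntegralSeq K d s i ∧ s.length = n
    have hb : ∀ n, P n → n ≤ d.length + 1 := by
      rintro n ⟨s, i, h, rfl⟩
      have := h.length_le
      have := h.le_length
      omega
    have h1 : P 1 := ⟨[0], 0, .start, rfl⟩
    obtain ⟨s, i, h, hs⟩ := Nat.findGreatest_spec (P := P) (hb 1 h1) h1
    refine ⟨s, i, h, fun s' i' h' => ?_⟩
    rw [hs]
    exact Nat.le_findGreatest (hb _ ⟨s', i', h', rfl⟩) ⟨s', i', h', rfl⟩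
  · intro s i h hmax
    refine h.clock_eq fun j h1 h2 h3 => ?_
    have := hmax _ _ (h.extend h1 h2 h3)
    simp at this

/-! ### The rescaling functions -/

/-- The bijection `f_{l → l'}` that scales `(0, l]` to `(0, l']` and `(l, 1)` to `(l', 1)`.
The first formula also covers `t = 0`, with value `0`. -/
def scale (l l' t : ℝ) : ℝ :=
  if t ≤ l then l' / l * t else l' + (1 - l') / (1 - l) * (t - l)

open Classical in
/-- The new delay `t'` of a delay `t`, for the current clock values `y` and `y'`: it is `t` if
`y, y'` are both integers or both greater than `K`; otherwise it has the same integral part as `t`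
and its fractional part is `f_{1 - {y} → 1 - {y'}}({t})`. -/
def rescaleDelay (K : ℕ) (y y' t : ℝ≥0) : ℝ≥0 :=
  if ((∃ n : ℕ, y = n) ∧ ∃ n : ℕ, y' = n) ∨ ((K : ℝ≥0) < y ∧ (K : ℝ≥0) < y') then t
  else ⌊t⌋₊ +
    (scale (1 - Int.fract (y : ℝ)) (1 - Int.fract (y' : ℝ)) (Int.fract (t : ℝ))).toNNReal

/-- The delays of a timestamp are rescaled from left to right, for current clock values `y`
and `y'`. -/
def rescaleFrom (K : ℕ) : ℝ≥0 → ℝ≥0 → List ℝ≥0 → List ℝ≥0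
  | _, _, [] => []
  | y, y', t :: d =>
    rescaleDelay K y y' t ::
      rescaleFrom K (resetAt K (y + t)) (resetAt K (y' + rescaleDelay K y y' t)) d

/-- The rescaling function `τ_{x → x'}` on timestamps. -/
def rescale (K : ℕ) (x x' : ℝ≥0) (d : List ℝ≥0) : List ℝ≥0 :=
  rescaleFrom K (clock K [x]) (clock K [x']) d

/-- The rescaling function `τ_{x → x'}` on timed words: the letters are kept. -/
def rescaleWord {A : Type*} (K : ℕ) (x x' : ℝ≥0) (w : TimedWord A) : TimedWord A :=
  (rescale K x x' (timestamp w)).zip (w.map Prod.snd)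

theorem rescale_nil (K : ℕ) (x x' : ℝ≥0) : rescale K x x' [] = [] := rfl

theorem rescaleFrom_append_singleton (K : ℕ) (d : List ℝ≥0) (t : ℝ≥0) : ∀ y y' : ℝ≥0,
    rescaleFrom K y y' (d ++ [t]) = rescaleFrom K y y' d ++
      [rescaleDelay K (d.foldl (fun x t => resetAt K (x + t)) y)
        ((rescaleFrom K y y' d).foldl (fun x t => resetAt K (x + t)) y') t] := by
  induction d with
  | nil => intro y y'; simp [rescaleFrom]
  | cons s d ih => intro y y'; simp [rescaleFrom, ih]

/-- The defining recursion `τ_{x → x'}(dt) = d't'` with `d' = τ_{x → x'}(d)`, where `t'` is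
determined by `t`, `y = c^K(xd)` and `y' = c^K(x'd')`. -/
theorem rescale_append_singleton (K : ℕ) (x x' : ℝ≥0) (d : List ℝ≥0) (t : ℝ≥0) :
    rescale K x x' (d ++ [t]) = rescale K x x' d ++
      [rescaleDelay K (clock K (x :: d)) (clock K (x' :: rescale K x x' d)) t] := by
  simp [rescale, rescaleFrom_append_singleton, clock]

/-- The rescaled fractional part is in `[0, 1)`, so that no truncation takes place in
`rescaleDelay`. -/
theorem scale_mem_Ico {l l' t : ℝ} (hl : 0 < l) (hl' : 0 < l') (hl1 : l' < 1)
    (ht : 0 ≤ t) (ht1 : t < 1) : scale l l' t ∈ Set.Ico (0 : ℝ) 1 := by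
  unfold scale
  split_ifs with h
  · refine ⟨by positivity, ?_⟩
    have : l' / l * t ≤ l' := by
      rw [div_mul_eq_mul_div, div_le_iff₀ hl]
      exact mul_le_mul_of_nonneg_left h hl'.le
    linarith
  · push Not at h
    have h1 : 0 < 1 - l := by linarith
    have h2 : 0 < 1 - l' := by linarith
    have h3 : 0 < t - l := by linarith
    refine ⟨by positivity, ?_⟩
    have : (1 - l') / (1 - l) * (t - l) < 1 - l' := by
      rw [div_mul_eq_mul_div, div_lt_iff₀ h1]
      exact mul_lt_mul_of_pos_left (by linarith) h2
    linarith

/-! ### Equivalences on timed words -/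

/-- `r` is `L`-preserving. -/
def LPreserving {A : Type*} (L : Set (TimedWord A)) (r : TimedWord A → TimedWord A → Prop) :
    Prop :=
  ∀ u v, r u v → (u ∈ L ↔ v ∈ L)

/-- `r` is `K`-monotonic. -/
def KMonotonic {A : Type*} (K : ℕ) (r : TimedWord A → TimedWord A → Prop) : Prop :=
  ∀ u v, r u v →
    RegionEq K (wordClock K u) (wordClock K v) ∧
    ∀ (a : A) (t t' : ℝ≥0), RegionEq K (wordClock K u + t) (wordClock K v + t') →
      r (u ++ [(t, a)]) (v ++ [(t', a)])

/-- `r` has finite index: the set of its classes is finite. -/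
def FiniteIndex {S : Type*} (r : S → S → Prop) : Prop :=
  (Set.range fun s : S => {s' : S | r s s'}).Finite

/-- The syntactic equivalence `≈^{L,K}`. -/
def SyntacticEquiv {A : Type*} (L : Set (TimedWord A)) (K : ℕ) (u v : TimedWord A) : Prop :=
  RegionEq K (wordClock K u) (wordClock K v) ∧
    rescaleWord K (wordClock K u) (wordClock K v) '' residual L u = residual L v

end IRTA

end

/-!
The clock value `c^K(u)` is the only quantity of the past of `u` that a one-clock automaton with
constants up to `K` has to measure, provided that it resets its clock at every integer between `0`
and `K`. An automaton with integer resets and constants up to `K` can only reset clocks when the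
value `c^K(u) + t` is such an integer, so each clock always exceeds `c^K(u)` by an integer; up to
`≡^K` there are finitely many such integers. Hence the `≡^K`-class of `c^K(u)`, together with the
states and the classes of the offsets that are reachable by `u`, defines a `K`-monotonic equivalence
of finite index that preserves the language.

The rescaling `τ` is the canonical choice of delays that keeps two words with `≡^K`-equivalent clock
values in step: `y ≡^K y'` implies `y + t ≡^K y' + t'`. A monotonic equivalence is therefore
preserved when `u` is extended by `w` and `v` by `τ(w)`, which makes it finer than `≈^{L,K}` if it
preserves `L`. So `≈^{L,K}` inherits monotonicity and finite index, and its classes are the states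
of a one-clock automaton whose guards are the regions, as in the Myhill–Nerode theorem.
-/

noncomputable section

namespace IRTA

/-! ### Regions -/

section Region

variable {K m n n' : ℕ} {x y z : ℝ≥0}

theorem fract_coe (x : ℝ≥0) : Int.fract (x : ℝ) = x - ⌊x⌋₊ := by
  rw [← Int.self_sub_floor, ← natCast_floor_eq_intCast_floor x.coe_nonneg]
  rfl

theorem fract_coe_eq_zero_iff : Int.fract (x : ℝ) = 0 ↔ x = ⌊x⌋₊ := by
  rw [fract_coe, sub_eq_zero, ← NNReal.coe_natCast, NNReal.coe_inj]

theorem eq_natCast_iff : x = m ↔ ⌊x⌋₊ = m ∧ Int.fract (x : ℝ) = 0 := by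
  rw [fract_coe_eq_zero_iff]
  constructor
  · rintro rfl
    simp only [Nat.floor_natCast, and_self]
  · rintro ⟨rfl, h⟩
    exact h

theorem lt_or_eq_natCast_or_mem_Ioo (K : ℕ) (x : ℝ≥0) :
    (K : ℝ≥0) < x ∨ (∃ m ≤ K, x = m) ∨ ∃ m < K, x ∈ Set.Ioo (m : ℝ≥0) (m + 1) := by
  rcases lt_or_ge (K : ℝ≥0) x with hK | hK
  · exact .inl hK
  rcases eq_or_lt_of_le (Nat.floor_le (zero_le (a := x))) with h | h
  · exact .inr (.inl ⟨⌊x⌋₊, Nat.floor_le_of_le hK, h.symm⟩)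
  · exact .inr (.inr ⟨⌊x⌋₊, by exact_mod_cast h.trans_le hK, h, Nat.lt_floor_add_one x⟩)

theorem regionEq_of_mem_Ioo (hx : x ∈ Set.Ioo (m : ℝ≥0) (m + 1))
    (hy : y ∈ Set.Ioo (m : ℝ≥0) (m + 1)) : RegionEq K x y := by
  have floor_eq {z : ℝ≥0} (hz : z ∈ Set.Ioo (m : ℝ≥0) (m + 1)) : ⌊z⌋₊ = m :=
    Nat.floor_eq_iff zero_le |>.2 ⟨hz.1.le, hz.2⟩
  refine .inl ⟨(floor_eq hx).trans (floor_eq hy).symm, ?_⟩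
  rw [fract_coe_eq_zero_iff, fract_coe_eq_zero_iff, floor_eq hx, floor_eq hy]
  exact iff_of_false hx.1.ne' hy.1.ne'

theorem regionEq_iff_cmp : RegionEq K x y ↔ ∀ m ≤ K, cmp x m = cmp y m := by
  constructor
  · rintro (⟨hfloor, hfract⟩ | ⟨hx, hy⟩) m hm
    · have hlt : x < m ↔ y < m := by
        rw [← Nat.floor_lt zero_le, ← Nat.floor_lt zero_le, hfloor]
      have heq : x = m ↔ y = m := by rw [eq_natCast_iff, eq_natCast_iff, hfloor, hfract]
      rcases lt_trichotomy x m with h | h | h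
      · rw [h.cmp_eq_lt, (hlt.1 h).cmp_eq_lt]
      · rw [h, heq.1 h]
      · have hy := lt_of_le_of_ne (not_lt.1 (mt hlt.2 h.not_gt)) (Ne.symm (mt heq.2 h.ne'))
        rw [h.cmp_eq_gt, hy.cmp_eq_gt]
    · have hmK : (m : ℝ≥0) ≤ K := by exact_mod_cast hm
      rw [(hmK.trans_lt hx).cmp_eq_gt, (hmK.trans_lt hy).cmp_eq_gt]
  · intro h
    rcases lt_or_eq_natCast_or_mem_Ioo K x with hx | ⟨m, hm, hx⟩ | ⟨m, hm, hx⟩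
    · exact .inr ⟨hx, (cmp_eq_gt_iff _ _).1 ((h K le_rfl).symm.trans hx.cmp_eq_gt)⟩
    · have hy : y = m := (eq_iff_eq_of_cmp_eq_cmp (h m hm)).1 hx
      rw [hx, hy]
      exact .inl ⟨rfl, Iff.rfl⟩
    · refine regionEq_of_mem_Ioo hx ⟨?_, ?_⟩
      · exact (cmp_eq_gt_iff _ _).1 ((h m hm.le).symm.trans hx.1.cmp_eq_gt)
      · have hcmp := h (m + 1) hm
        push_cast at hcmp
        exact (lt_iff_lt_of_cmp_eq_cmp hcmp).1 hx.2

/-- The regions of `≡^K`, encoded by the outcome of comparing a real with each of `0, …, K`.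
All regions of reals are of this form, but not every such tuple is the region of a real. -/
abbrev Region (K : ℕ) := Fin (K + 1) → Ordering

/-- The region of a non-negative real. -/
def region (K : ℕ) (x : ℝ≥0) : Region K := fun m => cmp x ((m : ℕ) : ℝ≥0)

theorem regionEq_iff_region_eq : RegionEq K x y ↔ region K x = region K y := by
  simp only [regionEq_iff_cmp, ← Nat.lt_succ_iff, funext_iff, Fin.forall_iff, region,
    Nat.succ_eq_add_one]

namespace RegionEq

theorem refl (K : ℕ) (x : ℝ≥0) : RegionEq K x x := regionEq_iff_region_eq.2 rfl

theorem symm (h : RegionEq K x y) : RegionEq K y x :=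
  regionEq_iff_region_eq.2 (regionEq_iff_region_eq.1 h).symm

theorem trans (h : RegionEq K x y) (h' : RegionEq K y z) : RegionEq K x z :=
  regionEq_iff_region_eq.2 ((regionEq_iff_region_eq.1 h).trans (regionEq_iff_region_eq.1 h'))

theorem cmp_eq (h : RegionEq K x y) (hm : m ≤ K) : cmp x m = cmp y m := regionEq_iff_cmp.1 h m hm

theorem lt_iff (h : RegionEq K x y) (hm : m ≤ K) : x < m ↔ y < m :=
  lt_iff_lt_of_cmp_eq_cmp (h.cmp_eq hm)

theorem le_iff (h : RegionEq K x y) (hm : m ≤ K) : x ≤ m ↔ y ≤ m :=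
  le_iff_le_of_cmp_eq_cmp (h.cmp_eq hm)

theorem eq_iff (h : RegionEq K x y) (hm : m ≤ K) : x = m ↔ y = m :=
  eq_iff_eq_of_cmp_eq_cmp (h.cmp_eq hm)

theorem ge_iff (h : RegionEq K x y) (hm : m ≤ K) : (m : ℝ≥0) ≤ x ↔ (m : ℝ≥0) ≤ y := by
  rw [← not_lt, ← not_lt, h.lt_iff hm]

theorem gt_iff (h : RegionEq K x y) (hm : m ≤ K) : (m : ℝ≥0) < x ↔ (m : ℝ≥0) < y := by
  rw [← not_le, ← not_le, h.le_iff hm]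

theorem add_natCast (h : RegionEq K x y) (hn : RegionEq K (n : ℝ≥0) n') :
    RegionEq K (x + n) (y + n') := by
  rcases le_or_gt n K with hnK | hnK
  · obtain rfl : n' = n := Nat.cast_injective ((hn.eq_iff hnK).1 rfl)
    refine regionEq_iff_cmp.2 fun m hm => ?_
    rcases le_or_gt n' m with hnm | hnm
    · obtain ⟨k, rfl⟩ := Nat.exists_eq_add_of_le' hnm
      simpa only [Nat.cast_add, cmp_add_right] using h.cmp_eq (m := k) (by omega)
    · have hlt : (m : ℝ≥0) < n' := by exact_mod_cast hnm
      rw [(hlt.trans_le le_add_self).cmp_eq_gt, (hlt.trans_le le_add_self).cmp_eq_gt]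
  · have hnK : (K : ℝ≥0) < n := by exact_mod_cast hnK
    exact .inr ⟨hnK.trans_le le_add_self, ((hn.gt_iff le_rfl).1 hnK).trans_le le_add_self⟩

theorem exists_eq_natCast_iff (h : RegionEq K x y) :
    (∃ m : ℕ, m ≤ K ∧ x = m) ↔ ∃ m : ℕ, m ≤ K ∧ y = m :=
  exists_congr fun _ => and_congr_right fun hm => h.eq_iff hm

end RegionEq

theorem resetAt_eq_self (hx : ¬ ∃ m : ℕ, m ≤ K ∧ x = m) : resetAt K x = x := if_neg hx

theorem RegionEq.exists_resetAt_add (h : RegionEq K x y) :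
    ∃ k : ℕ, x = resetAt K x + k ∧ y = resetAt K y + k := by
  by_cases hx : ∃ m : ℕ, m ≤ K ∧ x = m
  · obtain ⟨m, hm, hx⟩ := hx
    have hy := (h.eq_iff hm).1 hx
    exact ⟨m, by rw [resetAt_eq_zero hm hx, zero_add, hx],
      by rw [resetAt_eq_zero hm hy, zero_add, hy]⟩
  · have hy := mt h.exists_eq_natCast_iff.2 hx
    exact ⟨0, by rw [resetAt_eq_self hx, Nat.cast_zero, add_zero],
      by rw [resetAt_eq_self hy, Nat.cast_zero, add_zero]⟩

theorem RegionEq.resetAt (h : RegionEq K x y) :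
    RegionEq K (resetAt K x) (resetAt K y) := by
  by_cases hx : ∃ m : ℕ, m ≤ K ∧ x = m
  · obtain ⟨m, hm, hx⟩ := hx
    rw [resetAt_eq_zero hm hx, resetAt_eq_zero hm ((h.eq_iff hm).1 hx)]
    exact .refl K 0
  · rwa [resetAt_eq_self hx, resetAt_eq_self (mt h.exists_eq_natCast_iff.2 hx)]

theorem resetAt_zero (K : ℕ) : resetAt K 0 = 0 := resetAt_eq_zero K.zero_le Nat.cast_zero.symm

theorem resetAt_resetAt (K : ℕ) (x : ℝ≥0) : resetAt K (resetAt K x) = resetAt K x := by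
  by_cases hx : ∃ m : ℕ, m ≤ K ∧ x = m
  · obtain ⟨m, hm, hx⟩ := hx
    rw [resetAt_eq_zero hm hx, resetAt_zero]
  · rw [resetAt_eq_self hx, resetAt_eq_self hx]

end Region

/-! ### The clock value of a timed word -/

section WordClock

variable {A : Type*} (K : ℕ) (u : TimedWord A)

theorem wordClock_nil : wordClock K ([] : TimedWord A) = 0 := rfl

theorem wordClock_append_singleton (t : ℝ≥0) (a : A) :
    wordClock K (u ++ [(t, a)]) = resetAt K (wordClock K u + t) := by
  simp only [wordClock, timestamp, List.map_append, List.map_cons, List.map_nil,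
    clock_append_singleton]

theorem resetAt_wordClock : resetAt K (wordClock K u) = wordClock K u := by
  cases u using List.reverseRecOn with
  | nil => exact resetAt_zero K
  | append_singleton u p => rw [wordClock_append_singleton, resetAt_resetAt]

end WordClock

/-! ### Rescaling of a delay -/

section Scale

variable {l l' l'' : ℝ}

theorem scale_of_le {t : ℝ} (ht : t ≤ l) (l' : ℝ) : scale l l' t = l' / l * t := if_pos ht

theorem scale_of_lt {t : ℝ} (ht : l < t) (l' : ℝ) :
    scale l l' t = l' + (1 - l') / (1 - l) * (t - l) :=
  if_neg ht.not_ge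

theorem scale_self (hl : l ∈ Set.Ioo 0 1) (t : ℝ) : scale l l t = t := by
  have hl0 : l ≠ 0 := hl.1.ne'
  have hl1 : 1 - l ≠ 0 := sub_ne_zero.2 hl.2.ne'
  rcases le_or_gt t l with ht | ht
  · rw [scale_of_le ht, div_self hl0, one_mul]
  · rw [scale_of_lt ht, div_self hl1, one_mul, add_sub_cancel]

theorem scale_apply_left (hl : l ≠ 0) (l' : ℝ) : scale l l' l = l' := by
  rw [scale_of_le le_rfl, div_mul_cancel₀ _ hl]

theorem scale_strictMono (hl : l ∈ Set.Ioo 0 1) (hl' : l' ∈ Set.Ioo 0 1) :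
    StrictMono (scale l l') := by
  have slope_left : 0 < l' / l := div_pos hl'.1 hl.1
  have slope_right : 0 < (1 - l') / (1 - l) := div_pos (sub_pos.2 hl'.2) (sub_pos.2 hl.2)
  refine StrictMonoOn.Iic_union_Ici (a := l) ?_ ?_
  · intro s hs t ht hst
    rw [scale_of_le hs, scale_of_le ht]
    gcongr
  · intro s hs t _ hst
    rcases (Set.mem_Ici.1 hs).eq_or_lt with rfl | hls
    · rw [scale_apply_left hl.1.ne', scale_of_lt hst]
      exact lt_add_of_pos_right l' (mul_pos slope_right (sub_pos.2 hst))
    · rw [scale_of_lt hls, scale_of_lt (hls.trans hst)]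
      gcongr

theorem cmp_scale (hl : l ∈ Set.Ioo 0 1) (hl' : l' ∈ Set.Ioo 0 1) (t : ℝ) :
    cmp (scale l l' t) l' = cmp t l := by
  rw [← (scale_strictMono hl hl').cmp_map_eq t l, scale_apply_left hl.1.ne']

theorem scale_scale (hl : l ∈ Set.Ioo 0 1) (hl' : l' ∈ Set.Ioo 0 1) (t : ℝ) :
    scale l' l'' (scale l l' t) = scale l l'' t := by
  have hl0 : l ≠ 0 := hl.1.ne'
  have hl0' : l' ≠ 0 := hl'.1.ne'
  have hl1 : 1 - l ≠ 0 := sub_ne_zero.2 hl.2.ne'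
  have hl1' : 1 - l' ≠ 0 := sub_ne_zero.2 hl'.2.ne'
  have hcmp := cmp_scale hl hl' t
  rcases le_or_gt t l with ht | ht
  · rw [scale_of_le ((le_iff_le_of_cmp_eq_cmp hcmp).2 ht), scale_of_le ht, scale_of_le ht]
    field_simp
  · have hlt : l' < scale l l' t := (cmp_eq_gt_iff _ _).1 (hcmp.trans ht.cmp_eq_gt)
    rw [scale_of_lt hlt, scale_of_lt ht, scale_of_lt ht]
    field_simp
    ring

end Scale

section RescaleDelay

variable {K : ℕ} {y y' y'' : ℝ≥0}

/-- The clock values at which `τ` leaves the next delay unchanged: the integers, and the values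
larger than `K`. -/
def IsRigid (K : ℕ) (y : ℝ≥0) : Prop := (∃ n : ℕ, y = n) ∨ (K : ℝ≥0) < y

theorem one_sub_fract_mem_Ioo (hy : ¬ IsRigid K y) : 1 - Int.fract (y : ℝ) ∈ Set.Ioo (0 : ℝ) 1 := by
  have hfract : Int.fract (y : ℝ) ≠ 0 := fun h => hy (.inl ⟨_, fract_coe_eq_zero_iff.1 h⟩)
  have hpos : 0 < Int.fract (y : ℝ) := lt_of_le_of_ne (Int.fract_nonneg _) hfract.symm
  exact ⟨sub_pos.2 (Int.fract_lt_one _), sub_lt_self 1 hpos⟩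

theorem rescaleDelay_of_not_isRigid (hy : ¬ IsRigid K y) (y' t : ℝ≥0) :
    rescaleDelay K y y' t = ⌊t⌋₊ +
      (scale (1 - Int.fract (y : ℝ)) (1 - Int.fract (y' : ℝ)) (Int.fract (t : ℝ))).toNNReal :=
  if_neg fun h => hy (h.imp And.left And.left)

theorem RegionEq.eq_natCast_or_lt (h : RegionEq K y y') (hy : IsRigid K y) :
    (∃ n : ℕ, y = n ∧ y' = n) ∨ (K : ℝ≥0) < y ∧ (K : ℝ≥0) < y' := by
  rcases lt_or_ge (K : ℝ≥0) y with hK | hK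
  · exact .inr ⟨hK, (h.gt_iff le_rfl).1 hK⟩
  · obtain ⟨n, rfl⟩ := hy.resolve_right hK.not_gt
    exact .inl ⟨n, rfl, (h.eq_iff (by exact_mod_cast hK)).1 rfl⟩

theorem RegionEq.rescaleDelay_of_isRigid (h : RegionEq K y y') (hy : IsRigid K y) (t : ℝ≥0) :
    rescaleDelay K y y' t = t :=
  if_pos ((h.eq_natCast_or_lt hy).imp_left fun ⟨n, hn, hn'⟩ => ⟨⟨n, hn⟩, n, hn'⟩)

theorem RegionEq.isRigid (h : RegionEq K y y') (hy : IsRigid K y) : IsRigid K y' :=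
  (h.eq_natCast_or_lt hy).imp (fun ⟨n, _, hn'⟩ => ⟨n, hn'⟩) And.right

theorem RegionEq.isRigid_iff (h : RegionEq K y y') : IsRigid K y ↔ IsRigid K y' :=
  ⟨h.isRigid, h.symm.isRigid⟩

theorem RegionEq.floor_eq (h : RegionEq K y y') (hy : ¬ IsRigid K y) : ⌊y⌋₊ = ⌊y'⌋₊ := by
  rcases h with h | h
  · exact h.1
  · exact absurd (.inr h.1) hy

theorem floor_natCast_add_toNNReal_and_fract (k : ℕ) {s : ℝ} (hs : s ∈ Set.Ico (0 : ℝ) 1) :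
    ⌊(k : ℝ≥0) + s.toNNReal⌋₊ = k ∧ Int.fract (((k : ℝ≥0) + s.toNNReal : ℝ≥0) : ℝ) = s := by
  constructor
  · rw [add_comm, Nat.floor_add_natCast zero_le,
      Nat.floor_eq_zero.2 (Real.toNNReal_lt_one.2 hs.2), zero_add]
  · rw [NNReal.coe_add, Real.coe_toNNReal s hs.1, NNReal.coe_natCast, Int.fract_natCast_add,
      Int.fract_eq_self.2 hs]

theorem floor_rescaleDelay_and_fract (hy : ¬ IsRigid K y) (hy' : ¬ IsRigid K y') (t : ℝ≥0) :
    ⌊rescaleDelay K y y' t⌋₊ = ⌊t⌋₊ ∧ Int.fract (rescaleDelay K y y' t : ℝ) =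
      scale (1 - Int.fract (y : ℝ)) (1 - Int.fract (y' : ℝ)) (Int.fract (t : ℝ)) := by
  rw [rescaleDelay_of_not_isRigid hy]
  have hl' := one_sub_fract_mem_Ioo hy'
  exact floor_natCast_add_toNNReal_and_fract _ <| scale_mem_Ico (one_sub_fract_mem_Ioo hy).1
    hl'.1 hl'.2 (Int.fract_nonneg _) (Int.fract_lt_one _)

theorem natCast_floor_add_toNNReal_fract (t : ℝ≥0) :
    (⌊t⌋₊ : ℝ≥0) + (Int.fract (t : ℝ)).toNNReal = t := by
  rw [← NNReal.coe_inj, NNReal.coe_add, Real.coe_toNNReal _ (Int.fract_nonneg _), fract_coe,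
    NNReal.coe_natCast, add_sub_cancel]

theorem rescaleDelay_self (K : ℕ) (y t : ℝ≥0) : rescaleDelay K y y t = t := by
  by_cases hy : IsRigid K y
  · exact (RegionEq.refl K y).rescaleDelay_of_isRigid hy t
  · rw [rescaleDelay_of_not_isRigid hy, scale_self (one_sub_fract_mem_Ioo hy),
      natCast_floor_add_toNNReal_fract]

theorem rescaleDelay_rescaleDelay (h : RegionEq K y y') (h' : RegionEq K y' y'') (t : ℝ≥0) :
    rescaleDelay K y' y'' (rescaleDelay K y y' t) = rescaleDelay K y y'' t := by
  by_cases hy : IsRigid K y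
  · rw [h.rescaleDelay_of_isRigid hy, h'.rescaleDelay_of_isRigid (h.isRigid_iff.1 hy),
      (h.trans h').rescaleDelay_of_isRigid hy]
  · have hy' := mt h.isRigid_iff.2 hy
    obtain ⟨hfloor, hfract⟩ := floor_rescaleDelay_and_fract hy hy' t
    rw [rescaleDelay_of_not_isRigid hy', hfloor, hfract,
      scale_scale (one_sub_fract_mem_Ioo hy) (one_sub_fract_mem_Ioo hy'),
      rescaleDelay_of_not_isRigid hy]

theorem regionEq_of_cmp_eq {n : ℕ} {x y : ℝ≥0} (hx : x ∈ Set.Ioo (n : ℝ≥0) (n + 2))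
    (hy : y ∈ Set.Ioo (n : ℝ≥0) (n + 2)) (h : cmp x (n + 1) = cmp y (n + 1)) : RegionEq K x y := by
  have add_two : (n : ℝ≥0) + 2 = (n + 1 : ℕ) + 1 := by push_cast; ring
  rcases lt_trichotomy x (n + 1) with hx1 | hx1 | hx1
  · exact regionEq_of_mem_Ioo ⟨hx.1, hx1⟩ ⟨hy.1, (lt_iff_lt_of_cmp_eq_cmp h).1 hx1⟩
  · rw [hx1, (eq_iff_eq_of_cmp_eq_cmp h).1 hx1]
    exact .refl K _
  · have hy1 := (cmp_eq_gt_iff _ _).1 (h.symm.trans hx1.cmp_eq_gt)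
    refine regionEq_of_mem_Ioo (m := n + 1) ⟨?_, add_two ▸ hx.2⟩ ⟨?_, add_two ▸ hy.2⟩
    · exact_mod_cast hx1
    · exact_mod_cast hy1

theorem add_mem_Ioo (hy : ¬ IsRigid K y) (t : ℝ≥0) :
    y + t ∈ Set.Ioo ((⌊y⌋₊ + ⌊t⌋₊ : ℕ) : ℝ≥0) ((⌊y⌋₊ + ⌊t⌋₊ : ℕ) + 2) := by
  have hlt : (⌊y⌋₊ : ℝ≥0) < y :=
    lt_of_le_of_ne (Nat.floor_le zero_le) fun h => hy (.inl ⟨_, h.symm⟩)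
  constructor
  · rw [Nat.cast_add]
    exact add_lt_add_of_lt_of_le hlt (Nat.floor_le zero_le)
  · calc y + t < (⌊y⌋₊ + 1) + (⌊t⌋₊ + 1) :=
          add_lt_add (Nat.lt_floor_add_one y) (Nat.lt_floor_add_one t)
      _ = (⌊y⌋₊ + ⌊t⌋₊ : ℕ) + 2 := by push_cast; ring

theorem cmp_add_floor_add_one (y t : ℝ≥0) :
    cmp (y + t) ((⌊y⌋₊ + ⌊t⌋₊ : ℕ) + 1) = cmp (Int.fract (t : ℝ)) (1 - Int.fract (y : ℝ)) := by
  have coe_strictMono : StrictMono ((↑) : ℝ≥0 → ℝ) := fun _ _ => NNReal.coe_lt_coe.2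
  rw [← coe_strictMono.cmp_map_eq, fract_coe, fract_coe,
    ← cmp_add_right (t - ⌊t⌋₊ : ℝ) _ (y + ⌊t⌋₊)]
  congr 1 <;> push_cast <;> ring

theorem RegionEq.add_rescaleDelay (h : RegionEq K y y') (t : ℝ≥0) :
    RegionEq K (y + t) (y' + rescaleDelay K y y' t) := by
  by_cases hy : IsRigid K y
  · rw [h.rescaleDelay_of_isRigid hy]
    rcases h.eq_natCast_or_lt hy with ⟨n, rfl, rfl⟩ | ⟨hK, hK'⟩
    · exact .refl K _
    · exact .inr ⟨hK.trans_le le_self_add, hK'.trans_le le_self_add⟩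
  · have hy' := mt h.isRigid_iff.2 hy
    obtain ⟨hfloor, hfract⟩ := floor_rescaleDelay_and_fract hy hy' t
    have hN : ⌊y⌋₊ + ⌊t⌋₊ = ⌊y'⌋₊ + ⌊rescaleDelay K y y' t⌋₊ := by rw [hfloor, h.floor_eq hy]
    refine regionEq_of_cmp_eq (add_mem_Ioo hy t) (hN ▸ add_mem_Ioo hy' _) ?_
    rw [cmp_add_floor_add_one, hN, cmp_add_floor_add_one, hfract,
      cmp_scale (one_sub_fract_mem_Ioo hy) (one_sub_fract_mem_Ioo hy')]

end RescaleDelay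

/-! ### Rescaling of timed words -/

section RescaleWord

variable {A : Type*} {K : ℕ} {x x' x'' : ℝ≥0}

theorem rescaleWord_nil (K : ℕ) (x x' : ℝ≥0) : rescaleWord K x x' ([] : TimedWord A) = [] := rfl

theorem clock_singleton (K : ℕ) (x : ℝ≥0) : clock K [x] = resetAt K x := by
  rw [clock, List.foldl_cons, zero_add, List.foldl_nil]

theorem rescaleWord_cons (K : ℕ) (x x' t : ℝ≥0) (a : A) (w : TimedWord A) :
    rescaleWord K x x' ((t, a) :: w) =
      (rescaleDelay K (resetAt K x) (resetAt K x') t, a) ::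
        rescaleWord K (resetAt K x + t)
          (resetAt K x' + rescaleDelay K (resetAt K x) (resetAt K x') t) w := by
  simp only [rescaleWord, rescale, clock_singleton, timestamp, List.map_cons, rescaleFrom,
    List.zip_cons_cons]

theorem rescaleWord_self (K : ℕ) (x : ℝ≥0) (w : TimedWord A) : rescaleWord K x x w = w := by
  induction w generalizing x with
  | nil => rfl
  | cons p w ih => rw [rescaleWord_cons, rescaleDelay_self, ih]

theorem rescaleWord_rescaleWord (h : RegionEq K x x') (h' : RegionEq K x' x'')
    (w : TimedWord A) :
    rescaleWord K x' x'' (rescaleWord K x x' w) = rescaleWord K x x'' w := by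
  induction w generalizing x x' x'' with
  | nil => rfl
  | cons p w ih =>
    have htail := h.resetAt.add_rescaleDelay p.1
    have htail' := h'.resetAt.add_rescaleDelay
      (rescaleDelay K (resetAt K x) (resetAt K x') p.1)
    rw [rescaleDelay_rescaleDelay h.resetAt h'.resetAt] at htail'
    rw [rescaleWord_cons, rescaleWord_cons, rescaleWord_cons,
      rescaleDelay_rescaleDelay h.resetAt h'.resetAt, ih htail htail']

/-- The rescaling `τ_{x → x'}` as a bijection of timed words, with inverse `τ_{x' → x}`. -/
def rescaleWordEquiv (h : RegionEq K x x') : TimedWord A ≃ TimedWord A where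
  toFun := rescaleWord K x x'
  invFun := rescaleWord K x' x
  left_inv w := by rw [rescaleWord_rescaleWord h h.symm, rescaleWord_self]
  right_inv w := by rw [rescaleWord_rescaleWord h.symm h, rescaleWord_self]

theorem rescaleWord_resetAt (K : ℕ) (x x' : ℝ≥0) (w : TimedWord A) :
    rescaleWord K (resetAt K x) (resetAt K x') w = rescaleWord K x x' w := by
  simp only [rescaleWord, rescale, clock_singleton, resetAt_resetAt]

theorem rescaleWord_wordClock_cons (K : ℕ) (u v : TimedWord A) (t : ℝ≥0) (a : A)
    (w : TimedWord A) :
    rescaleWord K (wordClock K u) (wordClock K v) ((t, a) :: w) =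
      (rescaleDelay K (wordClock K u) (wordClock K v) t, a) ::
        rescaleWord K (wordClock K (u ++ [(t, a)]))
          (wordClock K (v ++ [(rescaleDelay K (wordClock K u) (wordClock K v) t, a)])) w := by
  rw [rescaleWord_cons, wordClock_append_singleton, wordClock_append_singleton,
    rescaleWord_resetAt, resetAt_wordClock, resetAt_wordClock]

end RescaleWord

/-! ### The syntactic equivalence -/

section SyntacticEquiv

variable {A : Type*} {L : Set (TimedWord A)} {K : ℕ} {r : TimedWord A → TimedWord A → Prop}
  {u v : TimedWord A}

theorem syntacticEquiv_iff :
    SyntacticEquiv L K u v ↔ RegionEq K (wordClock K u) (wordClock K v) ∧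
      ∀ w, u ++ w ∈ L ↔ v ++ rescaleWord K (wordClock K u) (wordClock K v) w ∈ L :=
  and_congr_right fun h =>
    ((rescaleWordEquiv h).eq_preimage_iff_image_eq _ _).symm.trans Set.ext_iff

theorem syntacticEquiv_equivalence (L : Set (TimedWord A)) (K : ℕ) :
    Equivalence (SyntacticEquiv L K) where
  refl u := syntacticEquiv_iff.2 ⟨.refl K _, fun w => by rw [rescaleWord_self]⟩
  symm {u v} huv := by
    obtain ⟨hreg, hL⟩ := syntacticEquiv_iff.1 huv
    refine syntacticEquiv_iff.2 ⟨hreg.symm, fun w => ?_⟩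
    rw [hL, rescaleWord_rescaleWord hreg.symm hreg, rescaleWord_self]
  trans {u v w} huv hvw := by
    obtain ⟨hreg, hL⟩ := syntacticEquiv_iff.1 huv
    obtain ⟨hreg', hL'⟩ := syntacticEquiv_iff.1 hvw
    refine syntacticEquiv_iff.2 ⟨hreg.trans hreg', fun z => ?_⟩
    rw [hL, hL', rescaleWord_rescaleWord hreg hreg']

theorem lPreserving_syntacticEquiv (L : Set (TimedWord A)) (K : ℕ) :
    LPreserving L (SyntacticEquiv L K) := fun u v huv => by
  simpa only [rescaleWord_nil, List.append_nil] using (syntacticEquiv_iff.1 huv).2 []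

theorem SyntacticEquiv.append_rescaleDelay (h : SyntacticEquiv L K u v) (t : ℝ≥0) (a : A) :
    SyntacticEquiv L K (u ++ [(t, a)])
      (v ++ [(rescaleDelay K (wordClock K u) (wordClock K v) t, a)]) := by
  obtain ⟨hreg, hL⟩ := syntacticEquiv_iff.1 h
  refine syntacticEquiv_iff.2 ⟨?_, fun w => ?_⟩
  · rw [wordClock_append_singleton, wordClock_append_singleton]
    exact (hreg.add_rescaleDelay t).resetAt
  · rw [List.append_assoc, List.append_assoc, List.singleton_append, List.singleton_append, hL,
      rescaleWord_wordClock_cons]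

theorem KMonotonic.append_rescaleWord (hr : KMonotonic K r) (h : r u v) (w : TimedWord A) :
    r (u ++ w) (v ++ rescaleWord K (wordClock K u) (wordClock K v) w) := by
  induction w generalizing u v with
  | nil => rwa [rescaleWord_nil, List.append_nil, List.append_nil]
  | cons p w ih =>
    obtain ⟨hreg, hstep⟩ := hr u v h
    rw [rescaleWord_wordClock_cons, List.append_cons u, List.append_cons v]
    exact ih (hstep p.2 p.1 _ (hreg.add_rescaleDelay p.1))

theorem KMonotonic.syntacticEquiv (hr : KMonotonic K r) (hL : LPreserving L r) (h : r u v) :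
    SyntacticEquiv L K u v :=
  syntacticEquiv_iff.2 ⟨(hr u v h).1, fun w => hL _ _ (hr.append_rescaleWord h w)⟩

theorem KMonotonic.kMonotonic_syntacticEquiv (hr : KMonotonic K r) (hL : LPreserving L r)
    (hrefl : ∀ u, r u u) : KMonotonic K (SyntacticEquiv L K) := by
  refine fun u v h => ⟨h.1, fun a t t' htt' => ?_⟩
  have hreg := (h.1.add_rescaleDelay t).symm.trans htt'
  exact (syntacticEquiv_equivalence L K).trans (h.append_rescaleDelay t a)
    (hr.syntacticEquiv hL ((hr v v (hrefl v)).2 a _ t' hreg))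

end SyntacticEquiv

/-! ### Equivalences of finite index -/

section FiniteIndex

variable {S T : Type*} {r r' : S → S → Prop}

theorem setOf_rel_eq_iff (hr : Equivalence r) {u v : S} :
    {s | r u s} = {s | r v s} ↔ r u v := by
  constructor
  · intro h
    exact (Set.ext_iff.1 h v).2 (hr.refl v)
  · intro h
    exact Set.ext fun s => ⟨hr.trans (hr.symm h), hr.trans h⟩

theorem finiteIndex_of_finite [Finite T] (hr : Equivalence r) (f : S → T)
    (hf : ∀ u v, f u = f v → r u v) : FiniteIndex r := by
  have hfactors : Function.FactorsThrough (fun u => {s | r u s}) f :=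
    fun u v h => (setOf_rel_eq_iff hr).2 (hf u v h)
  obtain ⟨g, hg⟩ := (Function.factorsThrough_iff _).1 hfactors
  rw [FiniteIndex, hg, Set.range_comp]
  exact (Set.toFinite _).image g

theorem FiniteIndex.exists_fin (h : FiniteIndex r) (hr : Equivalence r) :
    ∃ (n : ℕ) (cls : S → Fin n), ∀ u v, cls u = cls v ↔ r u v := by
  have : Finite (Set.range fun u => {s | r u s}) := h
  obtain ⟨n, ⟨e⟩⟩ := Finite.exists_equiv_fin (Set.range fun u => {s | r u s})
  refine ⟨n, fun u => e (Set.rangeFactorization _ u), fun u v => ?_⟩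
  exact e.apply_eq_iff_eq.trans (Subtype.ext_iff.trans (setOf_rel_eq_iff hr))

theorem FiniteIndex.mono (h : FiniteIndex r) (hr : Equivalence r) (hr' : Equivalence r')
    (hle : ∀ u v, r u v → r' u v) : FiniteIndex r' := by
  obtain ⟨n, cls, hcls⟩ := h.exists_fin hr
  exact finiteIndex_of_finite hr' cls fun u v huv => hle u v ((hcls u v).1 huv)

end FiniteIndex

section Recognizes

variable {A : Type*} {L : Set (TimedWord A)} {K : ℕ} {r : TimedWord A → TimedWord A → Prop}

/-- `r` is a `K`-monotonic equivalence of finite index that preserves `L`: the analogue for timed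
words of the right congruences of finite index that saturate a regular language. -/
structure Recognizes (K : ℕ) (r : TimedWord A → TimedWord A → Prop) (L : Set (TimedWord A)) :
    Prop where
  equivalence : Equivalence r
  kMonotonic : KMonotonic K r
  lPreserving : LPreserving L r
  finiteIndex : FiniteIndex r

theorem recognizes_syntacticEquiv_iff :
    Recognizes K (SyntacticEquiv L K) L ↔
      KMonotonic K (SyntacticEquiv L K) ∧ FiniteIndex (SyntacticEquiv L K) :=
  ⟨fun h => ⟨h.kMonotonic, h.finiteIndex⟩,
    fun h => ⟨syntacticEquiv_equivalence L K, h.1, lPreserving_syntacticEquiv L K, h.2⟩⟩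

theorem Recognizes.syntacticEquiv (h : Recognizes K r L) :
    Recognizes K (SyntacticEquiv L K) L :=
  recognizes_syntacticEquiv_iff.2
    ⟨h.kMonotonic.kMonotonic_syntacticEquiv h.lPreserving h.equivalence.refl,
      h.finiteIndex.mono h.equivalence (syntacticEquiv_equivalence L K)
        fun _ _ => h.kMonotonic.syntacticEquiv h.lPreserving⟩

end Recognizes

/-! ### One-clock automata as automata with several clocks -/

section OneTA

variable {A : Type*}

namespace OneTA

variable {B : OneTA A} {q q' : B.State} {x x' t : ℝ≥0} {a : A} {w : TimedWord A}

theorem run_nil_iff : B.Run q x [] q' x' ↔ q' = q ∧ x' = x := by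
  constructor
  · rintro ⟨⟩
    exact ⟨rfl, rfl⟩
  · rintro ⟨rfl, rfl⟩
    exact .nil _ _

theorem run_cons_iff :
    B.Run q x ((t, a) :: w) q' x' ↔ ∃ q₁ φ r, (q, q₁, a, φ, r) ∈ B.trans ∧
      x + t ∈ φ.denote ∧ B.Run q₁ ((r : ℕ) * (x + t)) w q' x' := by
  constructor
  · rintro (_ | ⟨htrans, hguard, hrun⟩)
    exact ⟨_, _, _, htrans, hguard, hrun⟩
  · rintro ⟨q₁, φ, r, htrans, hguard, hrun⟩
    exact .cons htrans hguard hrun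

end OneTA

namespace TA

variable {C : Type} {B : TA A C} {q q' : B.State} {ν ν' : C → ℝ≥0} {t : ℝ≥0} {a : A}
  {w : TimedWord A}

theorem run_nil_iff : B.Run q ν [] q' ν' ↔ q' = q ∧ ν' = ν := by
  constructor
  · rintro ⟨⟩
    exact ⟨rfl, rfl⟩
  · rintro ⟨rfl, rfl⟩
    exact .nil _ _

theorem run_cons_iff :
    B.Run q ν ((t, a) :: w) q' ν' ↔ ∃ q₁ φ R, (q, q₁, a, φ, R) ∈ B.trans ∧
      (fun x => ν x + t) ∈ φ.denote ∧ B.Run q₁ (resetClocks R fun x => ν x + t) w q' ν' := by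
  constructor
  · rintro (_ | ⟨htrans, hguard, hrun⟩)
    exact ⟨_, _, _, htrans, hguard, hrun⟩
  · rintro ⟨q₁, φ, R, htrans, hguard, hrun⟩
    exact .cons htrans hguard hrun

end TA

/-- A constraint on the only clock, as a guard over the clock `()`. -/
def OneGuard.toGuard : OneGuard → Guard Unit
  | .lt m => .lt () m
  | .gt m => .gt () m
  | .eq m => .eq () m
  | .and φ ψ => .and φ.toGuard ψ.toGuard

theorem OneGuard.mem_denote_toGuard {φ : OneGuard} {ν : Unit → ℝ≥0} :
    ν ∈ φ.toGuard.denote ↔ ν () ∈ φ.denote := by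
  induction φ with
  | lt m => rfl
  | gt m => rfl
  | eq m => rfl
  | and φ ψ ihφ ihψ => exact and_congr ihφ ihψ

theorem resetClocks_unit (r : Fin 2) (x : ℝ≥0) :
    resetClocks {_c : Unit | r = 0} (fun _ => x) = fun _ => ((r : ℕ) : ℝ≥0) * x := by
  funext _
  fin_cases r <;> simp [resetClocks]

namespace OneTA

variable {B : OneTA A} {q q' : B.State} {x x' : ℝ≥0} {a : A} {w : TimedWord A}

/-- A one-clock automaton, as an automaton over the clock `()`. -/
def toTA (B : OneTA A) : TA A Unit where
  State := B.State
  finite_state := B.finite_state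
  init := {B.init}
  trans := (fun (q, q', a, φ, r) => (q, q', a, φ.toGuard, {_c | r = 0})) '' B.trans
  finite_trans := B.finite_trans.image _
  final := B.final

theorem mem_trans_toTA {φ : Guard Unit} {R : Set Unit} :
    (q, q', a, φ, R) ∈ B.toTA.trans ↔
      ∃ φ₁ r, (q, q', a, φ₁, r) ∈ B.trans ∧ φ₁.toGuard = φ ∧ {_c | r = 0} = R := by
  constructor
  · rintro ⟨⟨_, _, _, φ₁, r⟩, htrans, heq⟩
    simp only [Prod.mk.injEq] at heq
    obtain ⟨rfl, rfl, rfl, hφ, hR⟩ := heq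
    exact ⟨φ₁, r, htrans, hφ, hR⟩
  · rintro ⟨φ₁, r, htrans, rfl, rfl⟩
    exact ⟨_, htrans, rfl⟩

theorem run_toTA_iff :
    B.toTA.Run q (fun _ => x) w q' (fun _ => x') ↔ B.Run q x w q' x' := by
  induction w generalizing q x with
  | nil =>
    refine TA.run_nil_iff.trans (Iff.trans ?_ run_nil_iff.symm)
    exact and_congr_right fun _ => funext_iff.trans (forall_const Unit)
  | cons p w ih =>
    refine TA.run_cons_iff.trans (Iff.trans ?_ run_cons_iff.symm)
    constructor
    · rintro ⟨q₁, _, _, htrans, hguard, hrun⟩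
      obtain ⟨φ, r, hmem, rfl, rfl⟩ := mem_trans_toTA.1 htrans
      rw [resetClocks_unit] at hrun
      exact ⟨q₁, φ, r, hmem, OneGuard.mem_denote_toGuard.1 hguard, ih.1 hrun⟩
    · rintro ⟨q₁, φ, r, htrans, hguard, hrun⟩
      refine ⟨q₁, _, _, mem_trans_toTA.2 ⟨φ, r, htrans, rfl, rfl⟩,
        OneGuard.mem_denote_toGuard.2 hguard, ?_⟩
      rw [resetClocks_unit]
      exact ih.2 hrun

theorem language_toTA (B : OneTA A) : B.toTA.language = B.language := by
  ext w
  constructor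
  · rintro ⟨_, rfl, q, hq, ν, hrun⟩
    exact ⟨q, hq, ν (), run_toTA_iff.1 hrun⟩
  · rintro ⟨q, hq, x, hrun⟩
    exact ⟨B.init, rfl, q, hq, _, run_toTA_iff.2 hrun⟩

theorem IntegerReset.toTA (hB : B.IntegerReset) : B.toTA.IntegerReset := by
  rintro q q' a _ _ htrans ⟨_, hR⟩
  obtain ⟨φ, r, hmem, rfl, rfl⟩ := mem_trans_toTA.1 htrans
  obtain rfl : r = 0 := hR
  obtain ⟨m, hm⟩ := hB q q' a φ hmem
  refine ⟨(), m, fun ν hν => ?_⟩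
  simpa only [hm, Set.mem_singleton_iff] using OneGuard.mem_denote_toGuard.1 hν

end OneTA

theorem OneClockIRTADefinable.irtaDefinable {L : Set (TimedWord A)}
    (h : OneClockIRTADefinable L) : IRTADefinable L := by
  obtain ⟨B, hB, -, rfl⟩ := h
  exact ⟨Unit, inferInstance, B.toTA, hB.toTA, B.language_toTA⟩

end OneTA

/-! ### From automata to equivalences -/

section TA

variable {A : Type*} {C : Type} {K : ℕ}

/-- The truth of `φ` depends only on the regions of the clock values. -/
def Guard.Regional (K : ℕ) (φ : Guard C) : Prop :=
  ∀ ν ν' : C → ℝ≥0, (∀ x, RegionEq K (ν x) (ν' x)) → (ν ∈ φ.denote ↔ ν' ∈ φ.denote)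

theorem Guard.eventually_regional (φ : Guard C) : ∀ᶠ K in Filter.atTop, φ.Regional K := by
  induction φ with
  | tt => exact .of_forall fun _ _ _ _ => Iff.rfl
  | lt x m => exact (Filter.eventually_ge_atTop m).mono fun _ hm _ _ h => (h x).lt_iff hm
  | le x m => exact (Filter.eventually_ge_atTop m).mono fun _ hm _ _ h => (h x).le_iff hm
  | eq x m => exact (Filter.eventually_ge_atTop m).mono fun _ hm _ _ h => (h x).eq_iff hm
  | ge x m => exact (Filter.eventually_ge_atTop m).mono fun _ hm _ _ h => (h x).ge_iff hm
  | gt x m => exact (Filter.eventually_ge_atTop m).mono fun _ hm _ _ h => (h x).gt_iff hm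
  | and φ ψ ihφ ihψ =>
    filter_upwards [ihφ, ihψ] with K hφ hψ ν ν' h using and_congr (hφ ν ν' h) (hψ ν ν' h)

open Classical in
/-- The distances of the clocks to a reference value `z` after the clocks in `R` have been reset,
if the distances were `n` and `z` has been lowered by `k` (to `0`, if `R` is nonempty). -/
def resetOffset (R : Set C) (k : ℕ) (n : C → ℕ) : C → ℕ :=
  fun x => if x ∈ R then 0 else n x + k

theorem RegionEq.resetOffset {n n' : C → ℕ} (h : ∀ x, RegionEq K (n x : ℝ≥0) (n' x))
    (R : Set C) (k : ℕ) (x : C) :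
    RegionEq K (resetOffset R k n x : ℝ≥0) (resetOffset R k n' x) := by
  by_cases hx : x ∈ R
  · simp only [IRTA.resetOffset, if_pos hx, RegionEq.refl]
  · simpa only [IRTA.resetOffset, if_neg hx, Nat.cast_add] using (h x).add_natCast (.refl K k)

theorem resetClocks_add {R : Set C} {z : ℝ≥0} {k : ℕ} (n : C → ℕ)
    (hk : z = resetAt K z + k) (hR : R.Nonempty → ∃ m : ℕ, m ≤ K ∧ z = m) :
    resetClocks R (fun x => z + n x) = fun x => resetAt K z + resetOffset R k n x := by
  funext x
  by_cases hx : x ∈ R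
  · obtain ⟨m, hm, hz⟩ := hR ⟨x, hx⟩
    simp only [resetClocks, resetOffset, if_pos hx, resetAt_eq_zero hm hz, Nat.cast_zero, add_zero]
  · simp only [resetClocks, resetOffset, if_neg hx, Nat.cast_add]
    rw [add_comm (n x : ℝ≥0), ← add_assoc, ← hk]

namespace TA

variable {B : TA A C} {q q' : B.State} {ν ν' : C → ℝ≥0} {u v : TimedWord A} {t t' : ℝ≥0} {a : A}

theorem run_append_singleton_iff :
    B.Run q ν (u ++ [(t, a)]) q' ν' ↔ ∃ q₁ ν₁ φ R, B.Run q ν u q₁ ν₁ ∧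
      (q₁, q', a, φ, R) ∈ B.trans ∧ (fun x => ν₁ x + t) ∈ φ.denote ∧
        ν' = resetClocks R fun x => ν₁ x + t := by
  induction u generalizing q ν with
  | nil =>
    simp only [List.nil_append, run_cons_iff, run_nil_iff]
    constructor
    · rintro ⟨_, φ, R, htrans, hguard, rfl, rfl⟩
      exact ⟨q, ν, φ, R, ⟨rfl, rfl⟩, htrans, hguard, rfl⟩
    · rintro ⟨_, _, φ, R, ⟨rfl, rfl⟩, htrans, hguard, rfl⟩
      exact ⟨q', φ, R, htrans, hguard, rfl, rfl⟩
  | cons p u ih =>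
    obtain ⟨s, b⟩ := p
    simp only [List.cons_append, run_cons_iff, ih]
    constructor
    · rintro ⟨q₂, φ₂, R₂, htrans, hguard, q₁, ν₁, φ, R, hrun, hlast⟩
      exact ⟨q₁, ν₁, φ, R, ⟨q₂, φ₂, R₂, htrans, hguard, hrun⟩, hlast⟩
    · rintro ⟨q₁, ν₁, φ, R, ⟨q₂, φ₂, R₂, htrans, hguard, hrun⟩, hlast⟩
      exact ⟨q₂, φ₂, R₂, htrans, hguard, q₁, ν₁, φ, R, hrun, hlast⟩

/-- `K` bounds the integers that the transitions of `B` refer to. -/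
structure BoundedBy (B : TA A C) (K : ℕ) : Prop where
  regional {q q' : B.State} {a : A} {φ : Guard C} {R : Set C} :
    (q, q', a, φ, R) ∈ B.trans → φ.Regional K
  integerReset {q q' : B.State} {a : A} {φ : Guard C} {R : Set C} :
    (q, q', a, φ, R) ∈ B.trans → R.Nonempty →
      ∃ (x : C) (c : ℕ), c ≤ K ∧ ∀ ν ∈ φ.denote, ν x = c

theorem IntegerReset.eventually_boundedBy (hB : B.IntegerReset) :
    ∀ᶠ K in Filter.atTop, B.BoundedBy K := by
  have hregional : ∀ᶠ K in Filter.atTop, ∀ p ∈ B.trans, p.2.2.2.1.Regional K :=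
    (Filter.eventually_all_finite B.finite_trans).2 fun p _ => p.2.2.2.1.eventually_regional
  have hreset : ∀ᶠ K in Filter.atTop, ∀ p ∈ B.trans, p.2.2.2.2.Nonempty →
      ∃ (x : C) (c : ℕ), c ≤ K ∧ ∀ ν ∈ p.2.2.2.1.denote, ν x = c := by
    refine (Filter.eventually_all_finite B.finite_trans).2 fun p hp => ?_
    by_cases hR : p.2.2.2.2.Nonempty
    · obtain ⟨x, c, hc⟩ := hB _ _ _ _ _ hp hR
      filter_upwards [Filter.eventually_ge_atTop c] with K hK _ using ⟨x, c, hK, hc⟩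
    · exact .of_forall fun _ h => absurd h hR
  filter_upwards [hregional, hreset] with K hK hK'
  exact ⟨fun hp => hK _ hp, fun hp => hK' _ hp⟩

theorem BoundedBy.exists_eq_natCast (hB : B.BoundedBy K) {φ : Guard C} {R : Set C}
    (htrans : (q, q', a, φ, R) ∈ B.trans) {z : ℝ≥0} {n : C → ℕ}
    (hguard : (fun x => z + n x) ∈ φ.denote) (hR : R.Nonempty) : ∃ m : ℕ, m ≤ K ∧ z = m := by
  obtain ⟨x, c, hcK, hc⟩ := hB.integerReset htrans hR
  have hzc : z + n x = c := hc _ hguard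
  refine ⟨c - n x, (Nat.sub_le _ _).trans hcK, ?_⟩
  rw [Nat.cast_tsub, ← hzc, add_tsub_cancel_right]

/-- Along some run on `u` from an initial configuration, `B` reaches the state `q` and clock values
that exceed `c^K(u)` by the integers `n`. -/
def Reaches (B : TA A C) (K : ℕ) (u : TimedWord A) (q : B.State) (n : C → ℕ) : Prop :=
  ∃ q₀ ∈ B.init, B.Run q₀ (fun _ => 0) u q fun x => wordClock K u + n x

theorem BoundedBy.exists_eq_wordClock_add (hB : B.BoundedBy K)
    (hrun : B.Run q (fun _ => 0) u q' ν) : ∃ n : C → ℕ, ν = fun x => wordClock K u + n x := by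
  induction u using List.reverseRecOn generalizing q' ν with
  | nil =>
    obtain ⟨rfl, rfl⟩ := run_nil_iff.1 hrun
    exact ⟨fun _ => 0, by simp only [wordClock_nil, Nat.cast_zero, add_zero]⟩
  | append_singleton u p ih =>
    obtain ⟨q₁, ν₁, φ, R, hrun₁, htrans, hguard, rfl⟩ := run_append_singleton_iff.1 hrun
    obtain ⟨n, rfl⟩ := ih hrun₁
    simp only [add_right_comm] at hguard ⊢
    obtain ⟨k, hk, -⟩ := (RegionEq.refl K (wordClock K u + p.1)).exists_resetAt_add
    refine ⟨resetOffset R k n, ?_⟩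
    rw [resetClocks_add n hk (hB.exists_eq_natCast htrans hguard), wordClock_append_singleton]

theorem BoundedBy.reaches_append_singleton_iff (hB : B.BoundedBy K) {k : ℕ} {n' : C → ℕ}
    (hk : wordClock K u + t = resetAt K (wordClock K u + t) + k) :
    B.Reaches K (u ++ [(t, a)]) q' n' ↔ ∃ q n φ R, B.Reaches K u q n ∧
      (q, q', a, φ, R) ∈ B.trans ∧ (fun x => wordClock K u + t + n x) ∈ φ.denote ∧
        n' = resetOffset R k n := by
  simp only [Reaches, run_append_singleton_iff, wordClock_append_singleton]
  constructor
  · rintro ⟨q₀, hq₀, q, ν, φ, R, hrun, htrans, hguard, hν⟩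
    obtain ⟨n, rfl⟩ := hB.exists_eq_wordClock_add hrun
    simp only [add_right_comm] at hguard hν
    rw [resetClocks_add n hk (hB.exists_eq_natCast htrans hguard)] at hν
    exact ⟨q, n, φ, R, ⟨q₀, hq₀, hrun⟩, htrans, hguard,
      funext fun x => Nat.cast_injective (add_left_cancel (congrFun hν x))⟩
  · rintro ⟨q, n, φ, R, ⟨q₀, hq₀, hrun⟩, htrans, hguard, rfl⟩
    refine ⟨q₀, hq₀, q, _, φ, R, hrun, htrans, ?_, ?_⟩
    · simpa only [add_right_comm] using hguard
    · simp only [add_right_comm _ _ t]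
      rw [resetClocks_add n hk (hB.exists_eq_natCast htrans hguard)]

/-- The states that `B` reaches by `u`, with the regions of the distances of the clocks to
`c^K(u)`. -/
def reach (B : TA A C) (K : ℕ) (u : TimedWord A) : Set (B.State × (C → Region K)) :=
  {p | ∃ n, B.Reaches K u p.1 n ∧ ∀ x, region K (n x) = p.2 x}

theorem BoundedBy.reach_append_singleton_subset (hB : B.BoundedBy K)
    (h : B.reach K u ⊆ B.reach K v) (htt' : RegionEq K (wordClock K u + t) (wordClock K v + t')) :
    B.reach K (u ++ [(t, a)]) ⊆ B.reach K (v ++ [(t', a)]) := by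
  rintro ⟨q', ρ⟩ ⟨n', hreachu', hρ⟩
  obtain ⟨k, hku, hkv⟩ := htt'.exists_resetAt_add
  obtain ⟨q, n, φ, R, hreachu, htrans, hguard, rfl⟩ :=
    (hB.reaches_append_singleton_iff hku).1 hreachu'
  have hmem : (q, fun x => region K (n x)) ∈ B.reach K u := ⟨n, hreachu, fun _ => rfl⟩
  obtain ⟨m, hreachv, hm⟩ := h hmem
  have hnm (x : C) : RegionEq K (n x : ℝ≥0) (m x) := regionEq_iff_region_eq.2 (hm x).symm
  refine ⟨resetOffset R k m, (hB.reaches_append_singleton_iff hkv).2 ⟨q, m, φ, R, hreachv, htrans,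
    (hB.regional htrans _ _ fun x => htt'.add_natCast (hnm x)).1 hguard, rfl⟩, fun x => ?_⟩
  exact (regionEq_iff_region_eq.1 (RegionEq.resetOffset hnm R k x)).symm.trans (hρ x)

theorem BoundedBy.mem_language_iff (hB : B.BoundedBy K) :
    u ∈ B.language ↔ ∃ p ∈ B.reach K u, p.1 ∈ B.final := by
  constructor
  · rintro ⟨q₀, hq₀, q, hq, ν, hrun⟩
    obtain ⟨n, rfl⟩ := hB.exists_eq_wordClock_add hrun
    exact ⟨(q, _), ⟨n, ⟨q₀, hq₀, hrun⟩, fun _ => rfl⟩, hq⟩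
  · rintro ⟨p, ⟨n, ⟨q₀, hq₀, hrun⟩, -⟩, hp⟩
    exact ⟨q₀, hq₀, p.1, hp, _, hrun⟩

/-- Two timed words are related if they have `≡^K`-equivalent clock values and lead `B` to the same
states, with the same regions for the distances of the clocks to these values. -/
def ReachEquiv (B : TA A C) (K : ℕ) (u v : TimedWord A) : Prop :=
  RegionEq K (wordClock K u) (wordClock K v) ∧ B.reach K u = B.reach K v

theorem BoundedBy.recognizes_reachEquiv [Finite C] (hB : B.BoundedBy K) :
    Recognizes K (B.ReachEquiv K) B.language := by
  have hequiv : Equivalence (B.ReachEquiv K) :=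
    ⟨fun u => ⟨.refl K _, rfl⟩, fun h => ⟨h.1.symm, h.2.symm⟩,
      fun h h' => ⟨h.1.trans h'.1, h.2.trans h'.2⟩⟩
  refine ⟨hequiv, fun u v h => ⟨h.1, fun a t t' htt' => ⟨?_, ?_⟩⟩, fun u v h => ?_, ?_⟩
  · rw [wordClock_append_singleton, wordClock_append_singleton]
    exact htt'.resetAt
  · exact (hB.reach_append_singleton_subset h.2.le htt').antisymm
      (hB.reach_append_singleton_subset h.2.ge htt'.symm)
  · rw [hB.mem_language_iff, hB.mem_language_iff, h.2]
  · have := B.finite_state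
    refine finiteIndex_of_finite hequiv (fun u => (region K (wordClock K u), B.reach K u))
      fun u v h => ?_
    exact ⟨regionEq_iff_region_eq.2 (congrArg Prod.fst h), congrArg Prod.snd h⟩

end TA

theorem IRTADefinable.exists_recognizes {L : Set (TimedWord A)} (h : IRTADefinable L) :
    ∃ (K : ℕ) (r : TimedWord A → TimedWord A → Prop), Recognizes K r L := by
  obtain ⟨C, _, B, hB, rfl⟩ := h
  obtain ⟨K, hK⟩ := hB.eventually_boundedBy.exists
  exact ⟨K, B.ReachEquiv K, hK.recognizes_reachEquiv⟩

end TA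

/-! ### From equivalences to one-clock automata -/

/-- The guard `x < m`, `x = m` or `m < x`. -/
def OneGuard.ofOrdering (m : ℕ) : Ordering → OneGuard
  | .lt => .lt m
  | .eq => .eq m
  | .gt => .gt m

theorem OneGuard.mem_denote_ofOrdering {m : ℕ} {o : Ordering} {x : ℝ≥0} :
    x ∈ (OneGuard.ofOrdering m o).denote ↔ cmp x m = o := by
  cases o with
  | lt => exact (cmp_eq_lt_iff x (m : ℝ≥0)).symm
  | eq => exact (cmp_eq_eq_iff x (m : ℝ≥0)).symm
  | gt => exact (cmp_eq_gt_iff x (m : ℝ≥0)).symm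

/-- The guard that describes a region. -/
def regionGuard : (K : ℕ) → Region K → OneGuard
  | 0, ρ => .ofOrdering 0 (ρ 0)
  | K + 1, ρ => .and (regionGuard K (Fin.init ρ)) (.ofOrdering (K + 1) (ρ (Fin.last (K + 1))))

theorem mem_denote_regionGuard {K : ℕ} {ρ : Region K} {x : ℝ≥0} :
    x ∈ (regionGuard K ρ).denote ↔ region K x = ρ := by
  simp only [funext_iff]
  induction K with
  | zero => rw [regionGuard, OneGuard.mem_denote_ofOrdering, Fin.forall_fin_one]; rfl
  | succ K ih =>
    rw [Fin.forall_fin_succ', regionGuard]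
    exact and_congr ih OneGuard.mem_denote_ofOrdering

/-- The bit of the transitions that are taken in the region `ρ`: the clock is reset in the regions
of the integers between `0` and `K`. -/
def resetBit {K : ℕ} (ρ : Region K) : Fin 2 := if ∃ m, ρ m = .eq then 0 else 1

theorem exists_region_eq_eq_iff {K : ℕ} {x : ℝ≥0} :
    (∃ m, region K x m = .eq) ↔ ∃ m : ℕ, m ≤ K ∧ x = m := by
  simp only [region, cmp_eq_eq_iff, Fin.exists_iff, Nat.lt_succ_iff, exists_prop]

theorem resetBit_region_eq_zero_iff {K : ℕ} {x : ℝ≥0} :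
    resetBit (region K x) = 0 ↔ ∃ m : ℕ, m ≤ K ∧ x = m := by
  rw [resetBit, ← exists_region_eq_eq_iff]
  exact ite_eq_left_iff.trans (not_imp_comm.trans (forall_prop_of_true one_ne_zero))

theorem resetBit_region_mul (K : ℕ) (x : ℝ≥0) :
    ((resetBit (region K x) : ℕ) : ℝ≥0) * x = resetAt K x := by
  simp only [resetBit, resetAt, exists_region_eq_eq_iff]
  split_ifs <;> simp

section QuotientTA

variable {A : Type*} [Finite A] {L : Set (TimedWord A)} {K N : ℕ} {cls : TimedWord A → Fin N}
  {r : TimedWord A → TimedWord A → Prop}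

/-- The automaton whose states are the classes of timed words given by `cls`: the letter `a`, read
after the delay `t`, leads from the class of `u` to the class of `u(t · a)`. -/
def quotientTA (K : ℕ) (cls : TimedWord A → Fin N) (L : Set (TimedWord A)) : OneTA A where
  State := Fin N
  finite_state := inferInstance
  init := cls []
  trans := {(q, q', a, φ, b) | ∃ u t, q = cls u ∧ q' = cls (u ++ [(t, a)]) ∧
    φ = regionGuard K (region K (wordClock K u + t)) ∧
    b = resetBit (region K (wordClock K u + t))}
  finite_trans := by
    refine (Set.finite_range fun p : Fin N × Fin N × A × Region K =>
      (p.1, p.2.1, p.2.2.1, regionGuard K p.2.2.2, resetBit p.2.2.2)).subset ?_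
    rintro ⟨_, _, _, _, _⟩ ⟨u, t, rfl, rfl, rfl, rfl⟩
    exact ⟨(_, _, _, _), rfl⟩
  final := cls '' L

theorem run_quotientTA_iff (hr : KMonotonic K r) (hcls : ∀ u v, cls u = cls v ↔ r u v)
    {u w : TimedWord A} {q : Fin N} {x : ℝ≥0} :
    (quotientTA K cls L).Run (cls u) (wordClock K u) w q x ↔
      q = cls (u ++ w) ∧ x = wordClock K (u ++ w) := by
  induction w generalizing u with
  | nil =>
    rw [List.append_nil]
    exact OneTA.run_nil_iff
  | cons p w ih =>
    obtain ⟨t, a⟩ := p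
    rw [List.append_cons, ← ih, wordClock_append_singleton, ← resetBit_region_mul]
    refine OneTA.run_cons_iff.trans ⟨?_, fun hrun => ?_⟩
    · rintro ⟨_, _, _, ⟨v, s, hclass, rfl, rfl, rfl⟩, hguard, hrun⟩
      have hregion := mem_denote_regionGuard.1 hguard
      have hclass' : cls (u ++ [(t, a)]) = cls (v ++ [(s, a)]) :=
        (hcls _ _).2 ((hr u v ((hcls u v).1 hclass)).2 a t s (regionEq_iff_region_eq.2 hregion))
      rwa [hclass', hregion]
    · exact ⟨_, _, _, ⟨u, t, rfl, rfl, rfl, rfl⟩, mem_denote_regionGuard.2 rfl, hrun⟩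

theorem integerReset_quotientTA : (quotientTA K cls L).IntegerReset := by
  rintro _ _ _ _ ⟨u, t, rfl, rfl, rfl, hbit⟩
  obtain ⟨m, hm, hx⟩ := resetBit_region_eq_zero_iff.1 hbit.symm
  refine ⟨m, Set.ext fun y => ?_⟩
  rw [mem_denote_regionGuard, ← regionEq_iff_region_eq, hx, Set.mem_singleton_iff]
  exact ⟨fun h => (h.eq_iff hm).2 rfl, fun h => h ▸ .refl K _⟩

theorem Recognizes.oneClockIRTADefinable (h : Recognizes K r L) : OneClockIRTADefinable L := by
  obtain ⟨N, cls, hcls⟩ := h.finiteIndex.exists_fin h.equivalence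
  have run_iff {w : TimedWord A} {q : Fin N} {x : ℝ≥0} :
      (quotientTA K cls L).Run (cls []) 0 w q x ↔ q = cls w ∧ x = wordClock K w :=
    run_quotientTA_iff (u := []) h.kMonotonic hcls
  refine ⟨quotientTA K cls L, integerReset_quotientTA, fun w => ⟨_, _, run_iff.2 ⟨rfl, rfl⟩⟩,
    Set.ext fun w => ⟨?_, fun hw => ⟨cls w, ⟨w, hw, rfl⟩, _, run_iff.2 ⟨rfl, rfl⟩⟩⟩⟩
  rintro ⟨_, ⟨u, hu, rfl⟩, x, hrun⟩
  exact (h.lPreserving u w ((hcls u w).1 (run_iff.1 hrun).1)).1 hu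

end QuotientTA

end IRTA

end

theorem mainTheorem1 {A : Type*} [Finite A] (L : Set (IRTA.TimedWord A)) :
    (∀ K : ℕ, Equivalence (IRTA.SyntacticEquiv L K)) ∧
    (IRTA.IRTADefinable L ↔
      ∃ K : ℕ, IRTA.KMonotonic K (IRTA.SyntacticEquiv L K) ∧
        IRTA.FiniteIndex (IRTA.SyntacticEquiv L K)) ∧
    (IRTA.OneClockIRTADefinable L ↔
      ∃ K : ℕ, IRTA.KMonotonic K (IRTA.SyntacticEquiv L K) ∧
        IRTA.FiniteIndex (IRTA.SyntacticEquiv L K)) ∧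
    (∀ (K : ℕ) (r : IRTA.TimedWord A → IRTA.TimedWord A → Prop),
      Equivalence r → IRTA.KMonotonic K r → IRTA.LPreserving L r →
        ∀ u v : IRTA.TimedWord A, r u v → IRTA.SyntacticEquiv L K u v) := by
  have recognizes_of_irtaDefinable (h : IRTA.IRTADefinable L) :
      ∃ K, IRTA.Recognizes K (IRTA.SyntacticEquiv L K) L := by
    obtain ⟨K, r, hr⟩ := h.exists_recognizes
    exact ⟨K, hr.syntacticEquiv⟩
  have oneClock_of_recognizes : (∃ K, IRTA.Recognizes K (IRTA.SyntacticEquiv L K) L) →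
      IRTA.OneClockIRTADefinable L := fun ⟨_, hK⟩ => hK.oneClockIRTADefinable
  simp only [← IRTA.recognizes_syntacticEquiv_iff]
  refine ⟨IRTA.syntacticEquiv_equivalence L, ?_, ?_, ?_⟩
  · exact ⟨recognizes_of_irtaDefinable, fun h => (oneClock_of_recognizes h).irtaDefinable⟩
  · exact ⟨fun h => recognizes_of_irtaDefinable h.irtaDefinable, oneClock_of_recognizes⟩
  · exact fun K r _ hmono hL u v => hmono.syntacticEquiv hL
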